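/- Consider the normal linear model with two variance components $Y\sim N(X\beta,\ \sigma_1^2V+\sigma_2^2I_n)$, where $X$ is a known real $n\times k$ matrix, $\beta\in\mathbb R^k$, $V$ is a known positive semidefinite $n\times n$ matrix, $\sigma_1^2\ge 0$ and $\sigma_2^2>0$. Put $\nu=n-\operatorname{rank}(X)$ and let $B$ be an $n\times\nu$ matrix with $BB^T=I_n-XX^+$ ($X^+$ the Moore–Penrose inverse) and $B^TB=I_\nu$; let $\tilde Y=B^TY$. Let $W=B^TVB=\sum_{i=1}^r\varrho_iD_i$ be the spectral decomposition: $\varrho_1>\dots>\varrho_r$ are the distinct eigenvalues of $W$, with multiplicities $\nu_i$, and the $D_i$ are symmetric idempotent matrices with $D_iD_j=0$ for $i\ne j$ and $\sum_iD_i=I_\nu$. Let $\vartheta_i=\sigma_1^2\varrho_i+\sigma_2^2$ be the (true) canonical variance components and $U_i=\tilde Y^TD_i\tilde Y$. For $\vartheta'\in(0,\infty)^r$ let $\operatorname{loglik}(\vartheta')$ be the logarithm of the density of $N(0,\sum_i\vartheta'_iD_i)$ at $\tilde Y$ (the restricted log-likelihood). For fixed $\vartheta_0=(\vartheta_{0,1},\dots,\vartheta_{0,r})\in(0,\infty)^r$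 let $$\mathrm{lrt}=-2\Big(\operatorname{loglik}(\vartheta_0)-\sup_{\vartheta'\in(0,\infty)^r}\operatorname{loglik}(\vartheta')\Big)$$ be the restricted likelihood ratio statistic for testing $H_0:\vartheta=\vartheta_0$ against $\vartheta\neq\vartheta_0$. For $\theta=(\theta_1,\theta_2,\theta_3)$ with $\theta_2,\theta_3>0$ let $\mathrm{LW}(\chi^2_d,\theta)$ be the law of $\theta_1-\theta_2\log Q+\theta_3Q$ with $Q\sim\chi^2_d$; the standard $\mathrm{LW}(\chi^2_d)$ law is the law of $(Q-d)-d\log(Q/d)$. Then: 1. For all $\vartheta'\in(0,\infty)^r$, $\operatorname{loglik}(\vartheta')=-\frac{\nu}{2}\log(2\pi)-\frac12\sum_i\nu_i\log\vartheta'_i-\frac12\sum_iU_i/\vartheta'_i$. 2. Almost surely $\hat\vartheta=(U_1/\nu_1,\dots,U_r/\nu_r)$ lies in $(0,\infty)^r$ and is the unique maximizer of $\operatorname{loglik}$ there, and $$\mathrm{lrt}=-2\big(\operatorname{loglik}(\vartheta_0)-\operatorname{loglik}(\hat\vartheta)\big)=\sum_{i=1}^rZ_i,\qquad Z_i=\Big(\frac{U_i}{\vartheta_{0,i}}-\nu_i\Big)-\nu_i\log\Big(\frac{U_i}{\nu_i\vartheta_{0,i}}\Big).$$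 3. The variables $Q_i=U_i/\vartheta_i$ are independent with $Q_i\sim\chi^2_{\nu_i}$, and with $\lambda_i=\vartheta_i/\vartheta_{0,i}$ one has $Z_i=(\lambda_iQ_i-\nu_i)-\nu_i\log(\lambda_iQ_i/\nu_i)$. 4. The variables $Z_1,\dots,Z_r$ are independent and $Z_i\sim\mathrm{LW}(\chi^2_{\nu_i},\theta_i)$ with $\theta_i=\big(\nu_i(\log(\nu_i/\lambda_i)-1),\nu_i,\lambda_i\big)$; thus $\mathrm{lrt}$ is distributed as a sum of $r$ independent variables with these laws. 5. Under $H_0$, that is if $\vartheta=\vartheta_0$, each $Z_i$ has the standard $\mathrm{LW}(\chi^2_{\nu_i})$ law, which is $\mathrm{LW}(\chi^2_{\nu_i},\theta_i)$ with $\theta_i=(\nu_i(\log\nu_i-1),\nu_i,1)$; thus $\mathrm{lrt}$ is distributed as a sum of $r$ independent standard $\mathrm{LW}(\chi^2_{\nu_i})$ variables. -/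

import Mathlib

open MeasureTheory ProbabilityTheory

namespace LambertLRT

/-- The four Penrose equations (for real matrices). -/
structure IsPenroseInverse {n k : ℕ} (X : Matrix (Fin n) (Fin k) ℝ)
    (G : Matrix (Fin k) (Fin n) ℝ) : Prop where
  mul_mul_self : X * G * X = X
  self_mul_mul : G * X * G = G
  symm_left : (X * G).transpose = X * G
  symm_right : (G * X).transpose = G * X

theorem exists_isPenroseInverse {n k : ℕ} (X : Matrix (Fin n) (Fin k) ℝ) :
    ∃ G, IsPenroseInverse X G := by
  classical
  have hA : (X.conjTranspose * X).IsHermitian := Matrix.isHermitian_conjTranspose_mul_self X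
  set U : Matrix (Fin k) (Fin k) ℝ := hA.eigenvectorUnitary.1 with hU
  set d : Fin k → ℝ := hA.eigenvalues with hd
  set U' : Matrix (Fin k) (Fin k) ℝ := star U with hU'
  have h1 : U' * U = 1 := Unitary.coe_star_mul_self hA.eigenvectorUnitary
  have hG : X.conjTranspose * X = U * Matrix.diagonal d * U' := by
    have := hA.spectral_theorem
    rw [Unitary.conjStarAlgAut_apply] at this
    exact this
  set S : Matrix (Fin k) (Fin k) ℝ := U * Matrix.diagonal (fun i => (d i)⁻¹) * U' with hS
  have hUU' : U'.conjTranspose = U := by simp [hU', Matrix.star_eq_conjTranspose]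
  have hU'U : U.conjTranspose = U' := by simp [hU', Matrix.star_eq_conjTranspose]
  have key : ∀ a b : Fin k → ℝ, (U * Matrix.diagonal a * U') * (U * Matrix.diagonal b * U')
      = U * Matrix.diagonal (fun i => a i * b i) * U' := by
    intro a b
    calc (U * Matrix.diagonal a * U') * (U * Matrix.diagonal b * U')
        = U * Matrix.diagonal a * (U' * U) * Matrix.diagonal b * U' := by
          simp only [Matrix.mul_assoc]
      _ = _ := by rw [h1, Matrix.mul_one, Matrix.mul_assoc U, Matrix.diagonal_mul_diagonal]
  have keyT : ∀ a : Fin k → ℝ, (U * Matrix.diagonal a * U').conjTranspose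
      = U * Matrix.diagonal a * U' := by
    intro a
    rw [Matrix.conjTranspose_mul, Matrix.conjTranspose_mul, hUU', hU'U,
      Matrix.diagonal_conjTranspose, Matrix.mul_assoc]
    rfl
  have hST : S.conjTranspose = S := keyT _
  have hSG : (S * (X.conjTranspose * X)).conjTranspose = S * (X.conjTranspose * X) := by
    rw [hG, hS, key, keyT]
  have hSGS : S * (X.conjTranspose * X) * S = S := by
    rw [hG, hS, key, key]
    congr 3
    funext i
    by_cases h : d i = 0 <;> simp [h]
  have hGSG : X.conjTranspose * X * (S * (X.conjTranspose * X)) = X.conjTranspose * X := by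
    rw [hG, hS, key, key]
    congr 3
    funext i
    by_cases h : d i = 0 <;> simp [h]
  have hXS : X * (S * (X.conjTranspose * X)) = X := by
    have h0 : X.conjTranspose * X * (S * (X.conjTranspose * X) - 1) = 0 := by
      rw [Matrix.mul_sub, hGSG, Matrix.mul_one, sub_self]
    have h2 := (Matrix.conjTranspose_mul_self_mul_eq_zero X _).1 h0
    rw [Matrix.mul_sub, Matrix.mul_one, sub_eq_zero] at h2
    exact h2
  refine ⟨S * X.conjTranspose, ?_, ?_, ?_, ?_⟩
  · calc X * (S * X.conjTranspose) * X = X * (S * (X.conjTranspose * X)) := by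
          simp only [Matrix.mul_assoc]
      _ = X := hXS
  · calc S * X.conjTranspose * X * (S * X.conjTranspose)
        = S * (X.conjTranspose * X) * S * X.conjTranspose := by simp only [Matrix.mul_assoc]
      _ = S * X.conjTranspose := by rw [hSGS]
  · rw [← Matrix.conjTranspose_eq_transpose_of_trivial, Matrix.conjTranspose_mul,
      Matrix.conjTranspose_mul, Matrix.conjTranspose_conjTranspose, hST, Matrix.mul_assoc]
  · rw [← Matrix.conjTranspose_eq_transpose_of_trivial, Matrix.mul_assoc, hSG]

theorem IsPenroseInverse.unique {n k : ℕ} {X : Matrix (Fin n) (Fin k) ℝ}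
    {G H : Matrix (Fin k) (Fin n) ℝ} (hG : IsPenroseInverse X G) (hH : IsPenroseInverse X H) :
    G = H := by
  have e1 : X * G = X * H := by
    calc X * G = (X * G).transpose := hG.symm_left.symm
      _ = ((X * H) * (X * G)).transpose := by rw [← Matrix.mul_assoc, hH.mul_mul_self]
      _ = (X * G) * (X * H) := by rw [Matrix.transpose_mul, hG.symm_left, hH.symm_left]
      _ = X * H := by rw [← Matrix.mul_assoc, hG.mul_mul_self]
  have e2 : G * X = H * X := by
    calc G * X = (G * X).transpose := hG.symm_right.symm
      _ = ((G * X) * (H * X)).transpose := by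
          rw [Matrix.mul_assoc, ← Matrix.mul_assoc X, hH.mul_mul_self]
      _ = (H * X) * (G * X) := by rw [Matrix.transpose_mul, hG.symm_right, hH.symm_right]
      _ = H * X := by rw [Matrix.mul_assoc, ← Matrix.mul_assoc X, hG.mul_mul_self]
  calc G = G * X * G := hG.self_mul_mul.symm
    _ = H * X * H := by rw [Matrix.mul_assoc, e1, ← Matrix.mul_assoc, e2]
    _ = H := hH.self_mul_mul

/-- The Moore-Penrose inverse of a real matrix: the unique solution of the Penrose equations. -/
noncomputable def pinv {n k : ℕ} (X : Matrix (Fin n) (Fin k) ℝ) : Matrix (Fin k) (Fin n) ℝ :=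
  (exists_isPenroseInverse X).choose

/-- `W = ∑ i, ϱ i • D i` is the spectral decomposition of `W`: the `ϱ i` are the distinct
eigenvalues of `W` in decreasing order, `ν i` is the multiplicity of `ϱ i`, and the `D i` are
mutually orthogonal symmetric idempotents that sum to the identity. -/
structure IsSpectralDecomposition {m r : ℕ} (W : Matrix (Fin m) (Fin m) ℝ) (ϱ : Fin r → ℝ)
    (ν : Fin r → ℕ) (D : Fin r → Matrix (Fin m) (Fin m) ℝ) : Prop where
  strictAnti : StrictAnti ϱ
  hasEigenvalue : ∀ i, Module.End.HasEigenvalue (Matrix.toLin' W) (ϱ i)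
  multiplicity : ∀ i, ν i = Module.finrank ℝ (Module.End.eigenspace (Matrix.toLin' W) (ϱ i))
  symm : ∀ i, (D i).IsSymm
  idem : ∀ i, D i * D i = D i
  orth : ∀ i j, i ≠ j → D i * D j = 0
  sum_one : ∑ i, D i = 1
  sum_smul : W = ∑ i, ϱ i • D i

/-- The density of the normal distribution `N(0, S)` on `ℝ^m`, `S` positive definite. -/
noncomputable def normalDensity {m : ℕ} (S : Matrix (Fin m) (Fin m) ℝ) (y : Fin m → ℝ) : ℝ :=
  (Real.sqrt ((2 * Real.pi) ^ m * S.det))⁻¹ * Real.exp (-(1 / 2) * (y ⬝ᵥ S⁻¹.mulVec y))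

/-- The restricted log-likelihood of the canonical variance components `ϑ`, given the value `y`
of the maximal invariant: the logarithm of the density of `N(0, ∑ i, ϑ i • D i)` at `y`. -/
noncomputable def loglik {m r : ℕ} (D : Fin r → Matrix (Fin m) (Fin m) ℝ) (ϑ : Fin r → ℝ)
    (y : Fin m → ℝ) : ℝ :=
  Real.log (normalDensity (∑ i, ϑ i • D i) y)

/-- The restricted likelihood ratio statistic for testing `ϑ = ϑ₀` against `ϑ ≠ ϑ₀`, the parameter
space of the canonical variance components being the set of vectors with positive entries. -/
noncomputable def lrt {m r : ℕ} (D : Fin r → Matrix (Fin m) (Fin m) ℝ) (ϑ₀ : Fin r → ℝ)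
    (y : Fin m → ℝ) : ℝ :=
  -2 * (loglik D ϑ₀ y - ⨆ ϑ : {ϑ : Fin r → ℝ // ∀ i, 0 < ϑ i}, loglik D ϑ.1 y)

/-- The chi-squared distribution with `ν ≥ 1` degrees of freedom, i.e. the gamma distribution with
shape `ν / 2` and rate `1 / 2`; its density on `[0, ∞)` is
`2 ^ (-ν / 2) / Γ(ν / 2) * x ^ (ν / 2 - 1) * exp (-x / 2)`. -/
noncomputable def chiSq (ν : ℕ) : Measure ℝ :=
  gammaMeasure ((ν : ℝ) / 2) (1 / 2)

/-- The distribution `LW(F, θ)`: the law of `θ₁ - θ₂ log X + θ₃ X` for `X ∼ F`. -/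
noncomputable def LW (F : Measure ℝ) (θ : ℝ × ℝ × ℝ) : Measure ℝ :=
  F.map (fun x => θ.1 - θ.2.1 * Real.log x + θ.2.2 * x)

/-- The standard log-Lambert W × chi-squared distribution with `ν` degrees of freedom: the law of
`(Q - ν) - ν log (Q / ν)` for `Q ∼ chiSq ν`. -/
noncomputable def standardLW (ν : ℕ) : Measure ℝ :=
  (chiSq ν).map (fun q => (q - ν) - ν * Real.log (q / ν))

end LambertLRT

-- In an orthonormal eigenbasis of `W` every `D i` becomes a coordinate projection
-- (`exists_diagonalization`), onto a block of `ν i` coordinates because its trace is the dimension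
-- of the eigenspace. Rotating `Bᵀ Y` to this basis and dividing each coordinate by its standard
-- deviation gives independent standard normals: `Bᵀ X = 0` removes the mean and `Bᵀ B = 1` keeps
-- the noise isotropic. Then `U i / ϑ i` is a sum of squares over block `i`, and disjoint blocks
-- give independent chi-squared variables (`map_block_sum_sq_pi_gaussianReal`,
-- `hasLaw_quadraticForms`).
--
-- The same diagonalization makes the determinant a product, so with `s i = U i / ν i` the
-- log-likelihood at `t` is a constant minus half the sum of `ν i * (log (t i) + s i / t i)`
-- (`loglik_eq`). The inequality `log x < x - 1` makes `t = s` the only maximizer as soon as all `U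
-- i > 0`, an almost sure event; evaluating there gives the sum of the `Z i`. Each `Z i` is a
-- function of `U i / ϑ i` alone, so independence and laws pass to the `Z i` and to their sum.

namespace LambertLRT

-- Chi-squared laws as laws of sums of squared standard normals.

/-- Probability measures on the line whose moment-generating functions are finite and equal near
zero are equal. -/
theorem ext_of_mgf_eqOn {μ ν : Measure ℝ} [IsProbabilityMeasure μ] [IsProbabilityMeasure ν]
    {c : ℝ} (hc : 0 < c) (hpos : ∀ t < c, 0 < mgf id μ t)
    (h : ∀ t < c, mgf id μ t = mgf id ν t) : μ = ν := by
  have key : ∀ {κ : Measure ℝ} [IsProbabilityMeasure κ], (∀ t < c, 0 < mgf id κ t) →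
      AnalyticOnNhd ℂ (complexMGF id κ) {z | z.re < c} := by
    intro κ _ hκ
    refine analyticOnNhd_complexMGF.mono fun z hz => ?_
    refine mem_interior.2 ⟨Set.Iio c, fun t ht => ?_, isOpen_Iio, hz⟩
    -- A non-integrable exponential would have integral 0 by convention, so positivity of the mgf
    -- encodes its finiteness.
    exact mgf_pos_iff.1 (hκ t ht)
  -- Identity theorem on a connected half-plane: agreement at the reals accumulating at 0 suffices.
  -- The half-plane contains the imaginary axis, where the complex mgf is the characteristic
  -- function.
  have heq : Set.EqOn (complexMGF id μ) (complexMGF id ν) {z | z.re < c} := by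
    refine (key hpos).eqOn_of_preconnected_of_frequently_eq
      (key fun t ht => h t ht ▸ hpos t ht)
      (convex_halfSpace_re_lt c).isPreconnected (z₀ := ((0 : ℝ) : ℂ)) (by simpa using hc) ?_
    have h_real : ∃ᶠ x : ℝ in nhdsWithin 0 {0}ᶜ, complexMGF id μ x = complexMGF id ν x := by
      refine Filter.Eventually.frequently ?_
      filter_upwards [nhdsWithin_le_nhds (Iio_mem_nhds hc)] with y hy
      rw [complexMGF_ofReal, complexMGF_ofReal, h y hy]
    have htend : Filter.Tendsto (fun x : ℝ => (x : ℂ)) (nhdsWithin 0 {0}ᶜ)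
        (nhdsWithin ((0 : ℝ) : ℂ) {((0 : ℝ) : ℂ)}ᶜ) := by
      refine tendsto_nhdsWithin_of_tendsto_nhds_of_eventually_within _
        (Complex.continuous_ofReal.continuousAt.tendsto.mono_left nhdsWithin_le_nhds) ?_
      filter_upwards [self_mem_nhdsWithin] with x hx
      simpa using hx
    exact htend.frequently h_real
  refine Measure.ext_of_charFun (funext fun t => ?_)
  have := @heq (t * Complex.I) (by simpa using hc)
  rwa [complexMGF_id_mul_I, complexMGF_id_mul_I] at this

/-- The factor `exp (t x)` turns the rate `r` into `r - t`, leaving a Gamma integral. -/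
theorem mgf_gammaMeasure {a r t : ℝ} (ha : 0 < a) (hr : 0 < r) (ht : t < r) :
    mgf id (gammaMeasure a r) t = (1 - t / r) ^ (-a) := by
  have hrt : 0 < r - t := sub_pos.2 ht
  have hmeas : Measurable (gammaPDF a r) := (measurable_gammaPDFReal a r).ennreal_ofReal
  rw [mgf, gammaMeasure, integral_withDensity_eq_integral_toReal_smul hmeas
    (by simp [gammaPDF])]
  have hz : ∀ x ∉ Set.Ici (0 : ℝ),
      (gammaPDF a r x).toReal • Real.exp (t * id x) = 0 := by
    intro x hx
    rw [gammaPDF_of_neg (not_le.1 hx)]; simp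
  rw [← setIntegral_eq_integral_of_forall_compl_eq_zero hz, integral_Ici_eq_integral_Ioi]
  have : ∀ x ∈ Set.Ioi (0 : ℝ), (gammaPDF a r x).toReal • Real.exp (t * id x)
      = (r ^ a / Real.Gamma a) * (x ^ (a - 1) * Real.exp (-((r - t) * x))) := by
    intro x hx
    have hx0 : (0 : ℝ) ≤ x := le_of_lt hx
    rw [gammaPDF, ENNReal.toReal_ofReal (gammaPDFReal_nonneg ha hr x), gammaPDFReal, if_pos hx0,
      smul_eq_mul, id, mul_assoc, mul_assoc, ← Real.exp_add]
    ring_nf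
  rw [setIntegral_congr_fun measurableSet_Ioi this, integral_const_mul,
    Real.integral_rpow_mul_exp_neg_mul_Ioi ha hrt]
  have e : 1 - t / r = (r - t) / r := by field_simp
  rw [e, Real.rpow_neg (by positivity), Real.div_rpow hrt.le hr.le,
    Real.div_rpow zero_le_one hrt.le, Real.one_rpow]
  have := (Real.Gamma_pos_of_pos ha).ne'
  field_simp

/-- A Gaussian integral, written in the shape of `mgf_gammaMeasure` with shape and rate 1/2. -/
theorem mgf_sq_gaussianReal {t : ℝ} (ht : t < 1 / 2) :
    ∫ x, Real.exp (t * x ^ 2) ∂(gaussianReal 0 1) = (1 - t / (1 / 2)) ^ (-(1 / 2) : ℝ) := by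
  have h1 : 0 < 1 - 2 * t := by linarith
  rw [integral_gaussianReal_eq_integral_smul one_ne_zero]
  have : ∀ x : ℝ, gaussianPDFReal 0 1 x • Real.exp (t * x ^ 2)
      = (Real.sqrt (2 * Real.pi))⁻¹ * Real.exp (-(1 / 2 - t) * x ^ 2) := by
    intro x
    simp only [gaussianPDFReal, NNReal.coe_one, mul_one, sub_zero, smul_eq_mul]
    rw [mul_assoc, ← Real.exp_add]
    ring_nf
  simp_rw [this]
  rw [integral_const_mul, integral_gaussian, Real.rpow_neg (by linarith), ← Real.sqrt_eq_rpow,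
    ← Real.sqrt_inv, ← Real.sqrt_inv, ← Real.sqrt_mul (by positivity)]
  congr 1
  have h2 : 1 / 2 - t ≠ 0 := by linarith
  have h3 : 1 - t / (1 / 2) ≠ 0 := by
    rw [show 1 - t / (1 / 2) = 1 - 2 * t by ring]; exact h1.ne'
  have := Real.pi_pos.ne'
  field_simp

theorem isProbabilityMeasure_chiSq {d : ℕ} (hd : 0 < d) : IsProbabilityMeasure (chiSq d) :=
  isProbabilityMeasure_gammaMeasure (by positivity) (by norm_num)

/-- The mgf factors over the coordinates, and `d` factors with exponent -1/2 multiply to the gamma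
mgf with exponent `-d/2`. -/
theorem map_sum_sq_pi_gaussianReal {d : ℕ} (hd : 0 < d) :
    (Measure.pi fun _ : Fin d => gaussianReal 0 1).map (fun x => ∑ j, x j ^ 2) = chiSq d := by
  have hm : Measurable fun x : Fin d → ℝ => ∑ j, x j ^ 2 := by fun_prop
  have : IsProbabilityMeasure (chiSq d) := isProbabilityMeasure_chiSq hd
  have : IsProbabilityMeasure ((Measure.pi fun _ : Fin d => gaussianReal 0 1).map
    (fun x => ∑ j, x j ^ 2)) := Measure.isProbabilityMeasure_map hm.aemeasurable
  have h1 : ∀ t < (1 / 2 : ℝ), mgf id (chiSq d) t = (1 - t / (1 / 2)) ^ (-(d / 2) : ℝ) :=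
    fun t ht => mgf_gammaMeasure (by positivity) (by norm_num) ht
  have hp : ∀ t < (1 / 2 : ℝ), 0 < 1 - t / (1 / 2) := fun t ht => by
    rw [show 1 - t / (1 / 2) = 1 - 2 * t by ring]; linarith
  refine (ext_of_mgf_eqOn (c := 1 / 2) (by norm_num)
    (fun t ht => h1 t ht ▸ Real.rpow_pos_of_pos (hp t ht) _) fun t ht => ?_).symm
  rw [h1 t ht, mgf, integral_map hm.aemeasurable (by fun_prop)]
  simp only [id, Finset.mul_sum, Real.exp_sum]
  rw [integral_fintype_prod_eq_prod (𝕜 := ℝ) (fun _ x => Real.exp (t * x ^ 2))]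
  simp only [mgf_sq_gaussianReal ht, Finset.prod_const, Finset.card_univ, Fintype.card_fin]
  rw [← Real.rpow_natCast, ← Real.rpow_mul (hp t ht).le]
  ring_nf

/-- The one-dimensional integral stays unevaluated: the block argument only has to count its
factors, and no complex power arises. -/
theorem charFun_chiSq {d : ℕ} (hd : 0 < d) (t : ℝ) :
    charFun (chiSq d) t
      = (∫ x, Complex.exp (t * (x ^ 2 : ℝ) * Complex.I) ∂(gaussianReal 0 1)) ^ d := by
  rw [← map_sum_sq_pi_gaussianReal hd, charFun_apply_real,
    integral_map (Measurable.aemeasurable (by fun_prop)) (by fun_prop)]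
  simp only [Complex.ofReal_sum, Finset.mul_sum, Finset.sum_mul, Complex.exp_sum]
  rw [integral_fintype_prod_eq_prod (𝕜 := ℂ)
    (fun _ x => Complex.exp (t * (x ^ 2 : ℝ) * Complex.I))]
  simp

/-- Sums of squares of independent standard normal variables over the blocks of a partition are
independent chi-squared variables. -/
theorem map_block_sum_sq_pi_gaussianReal {m r : ℕ} (f : Fin m → Fin r) (ν : Fin r → ℕ)
    (hν : ∀ i, 0 < ν i) (hf : ∀ i, ({j | f j = i} : Finset (Fin m)).card = ν i) :
    (Measure.pi fun _ : Fin m => gaussianReal 0 1).map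
      (fun x i => ∑ j with f j = i, x j ^ 2) = Measure.pi fun i => chiSq (ν i) := by
  have (i : Fin r) : IsProbabilityMeasure (chiSq (ν i)) := isProbabilityMeasure_chiSq (hν i)
  have hm : Measurable fun (x : Fin m → ℝ) (i : Fin r) => ∑ j with f j = i, x j ^ 2 := by
    fun_prop
  refine charFun_eq_pi_iff.1 fun t => ?_
  rw [charFun_apply, integral_map (by fun_prop) (by fun_prop),
    integral_map hm.aemeasurable (by fun_prop)]
  -- Every coordinate lies in exactly one block, so the exponential of the block sums is a product
  -- over single coordinates.
  have e : ∀ x : Fin m → ℝ, Complex.exp ((inner ℝ (WithLp.toLp 2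
      (fun i => ∑ j with f j = i, x j ^ 2)) t : ℝ) * Complex.I)
      = ∏ j, Complex.exp (t (f j) * (x j ^ 2 : ℝ) * Complex.I) := by
    intro x
    rw [← Complex.exp_sum, PiLp.inner_apply, ← Finset.sum_mul]
    congr 2
    simp only [RCLike.inner_apply, conj_trivial, Finset.mul_sum]
    push_cast
    rw [← Finset.sum_fiberwise (s := Finset.univ) (g := f)]
    refine Finset.sum_congr rfl fun i _ => Finset.sum_congr rfl fun j hj => ?_
    rw [(Finset.mem_filter.1 hj).2]
  simp_rw [e]
  rw [integral_fintype_prod_eq_prod (𝕜 := ℂ)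
    (fun j x => Complex.exp (t (f j) * (x ^ 2 : ℝ) * Complex.I)),
    ← Finset.prod_fiberwise (s := Finset.univ) (g := f)]
  refine Finset.prod_congr rfl fun i _ => ?_
  rw [charFun_chiSq (hν i), ← hf i]
  refine Finset.prod_eq_pow_card fun j hj => ?_
  rw [(Finset.mem_filter.1 hj).2]

theorem ae_chiSq_pos (d : ℕ) : ∀ᵐ q ∂(chiSq d), 0 < q := by
  rw [ae_iff, chiSq, gammaMeasure]
  simp only [not_lt]
  rw [show {q : ℝ | q ≤ 0} = Set.Iic 0 from rfl, withDensity_apply _ measurableSet_Iic,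
    ← setLIntegral_congr (Iio_ae_eq_Iic (μ := volume)), lintegral_gammaPDF_of_nonpos le_rfl]

-- Spectral decomposition: multiplicities, diagonalization, determinant and log-likelihood.

namespace IsSpectralDecomposition

variable {m r : ℕ} {W : Matrix (Fin m) (Fin m) ℝ} {ϱ : Fin r → ℝ} {ν : Fin r → ℕ}
  {D : Fin r → Matrix (Fin m) (Fin m) ℝ}

theorem mul_right (h : IsSpectralDecomposition W ϱ ν D) (i : Fin r) : W * D i = ϱ i • D i := by
  rw [h.sum_smul, Finset.sum_mul, Finset.sum_eq_single i]
  · rw [Matrix.smul_mul, h.idem]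
  · intro k _ hk
    rw [Matrix.smul_mul, h.orth k i hk, smul_zero]
  · simp

theorem mul_left (h : IsSpectralDecomposition W ϱ ν D) (i : Fin r) : D i * W = ϱ i • D i := by
  rw [h.sum_smul, Finset.mul_sum, Finset.sum_eq_single i]
  · rw [Matrix.mul_smul, h.idem]
  · intro k _ hk
    rw [Matrix.mul_smul, h.orth i k hk.symm, smul_zero]
  · simp

theorem isSymm (h : IsSpectralDecomposition W ϱ ν D) : W.IsSymm := by
  rw [Matrix.IsSymm, h.sum_smul, Matrix.transpose_sum]
  exact Finset.sum_congr rfl fun i _ => by rw [Matrix.transpose_smul, (h.symm i).eq]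

theorem multiplicity_pos (h : IsSpectralDecomposition W ϱ ν D) (i : Fin r) : 0 < ν i := by
  rw [h.multiplicity i]
  have : Nontrivial (Module.End.eigenspace (Matrix.toLin' W) (ϱ i)) :=
    Submodule.nontrivial_iff_ne_bot.2 (h.hasEigenvalue i)
  exact Module.finrank_pos

/-- For an eigenvector `x` of `ϱ i`, computing `D k W x` in two ways gives `ϱ k D k x = ϱ i D k x`.
Distinct eigenvalues kill `D k x` for `k ≠ i`, and the resolution of the identity leaves `D i x =
x`. -/
theorem isProj_eigenspace (h : IsSpectralDecomposition W ϱ ν D) (i : Fin r) :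
    LinearMap.IsProj (Module.End.eigenspace (Matrix.toLin' W) (ϱ i)) (Matrix.toLin' (D i)) where
  map_mem x := by
    rw [Module.End.mem_eigenspace_iff, Matrix.toLin'_apply, Matrix.toLin'_apply,
      Matrix.mulVec_mulVec, h.mul_right, Matrix.smul_mulVec]
  map_id x hx := by
    rw [Module.End.mem_eigenspace_iff, Matrix.toLin'_apply] at hx
    have h0 : ∀ k, k ≠ i → (D k).mulVec x = 0 := by
      intro k hk
      have e : ϱ k • (D k).mulVec x = ϱ i • (D k).mulVec x := by
        rw [← Matrix.smul_mulVec, ← h.mul_left, ← Matrix.mulVec_mulVec, hx, Matrix.mulVec_smul]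
      rw [← sub_eq_zero, ← sub_smul, smul_eq_zero, sub_eq_zero] at e
      exact e.resolve_left fun e' => hk (h.strictAnti.injective e')
    have : (∑ k, D k).mulVec x = x := by rw [h.sum_one, Matrix.one_mulVec]
    rw [Matrix.sum_mulVec, Finset.sum_eq_single i (fun k _ hk => h0 k hk) (by simp)] at this
    rwa [Matrix.toLin'_apply]

theorem trace_eq (h : IsSpectralDecomposition W ϱ ν D) (i : Fin r) : (D i).trace = ν i := by
  rw [h.multiplicity i, ← (h.isProj_eigenspace i).trace, Matrix.trace_toLin'_eq]

/-- The matrices of a spectral decomposition are simultaneously diagonal in an orthonormal basis: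
the `j`-th basis vector belongs to the eigenvalue with index `f j`. -/
theorem exists_diagonalization (h : IsSpectralDecomposition W ϱ ν D) :
    ∃ (O : Matrix (Fin m) (Fin m) ℝ) (f : Fin m → Fin r), O.transpose * O = 1 ∧
      (∀ i, D i = O * Matrix.diagonal (fun j => if f j = i then 1 else 0) * O.transpose) ∧
      ∀ i, ({j | f j = i} : Finset (Fin m)).card = ν i := by
  have hW : W.IsHermitian := by
    rw [Matrix.IsHermitian, Matrix.conjTranspose_eq_transpose_of_trivial]
    exact h.isSymm
  set O : Matrix (Fin m) (Fin m) ℝ := hW.eigenvectorUnitary.1 with hO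
  set d : Fin m → ℝ := hW.eigenvalues with hd
  have hstar : star O = O.transpose := by
    rw [Matrix.star_eq_conjTranspose, Matrix.conjTranspose_eq_transpose_of_trivial]
  have h1 : O.transpose * O = 1 := hstar ▸ Unitary.coe_star_mul_self hW.eigenvectorUnitary
  have h2 : O * O.transpose = 1 := mul_eq_one_comm.1 h1
  have hWd : W = O * Matrix.diagonal d * O.transpose := by
    have := hW.spectral_theorem
    rw [Unitary.conjStarAlgAut_apply] at this
    rw [← hstar]
    exact this
  set E : Fin r → Matrix (Fin m) (Fin m) ℝ := fun i => O.transpose * D i * O with hE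
  have hDE : ∀ i, D i = O * E i * O.transpose := by
    intro i
    calc D i = (O * O.transpose) * D i * (O * O.transpose) := by simp [h2]
      _ = _ := by simp only [hE, Matrix.mul_assoc]
  have hEsum : ∑ i, E i = 1 := by
    simp only [hE]
    rw [← Finset.sum_mul, ← Finset.mul_sum, h.sum_one, Matrix.mul_one, h1]
  have hEd : ∀ i, Matrix.diagonal d * E i = ϱ i • E i := by
    intro i
    calc Matrix.diagonal d * E i
        = (O.transpose * O) * Matrix.diagonal d * O.transpose * D i * O := by
          rw [h1, Matrix.one_mul]; simp only [hE, Matrix.mul_assoc]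
      _ = O.transpose * (W * D i) * O := by rw [hWd]; simp only [Matrix.mul_assoc]
      _ = ϱ i • E i := by rw [h.mul_right, Matrix.mul_smul, Matrix.smul_mul]
  -- In the eigenbasis, `W * D i = ϱ i • D i` reads `(d j - ϱ i) * E i j l = 0`.
  have hent : ∀ i j l, d j ≠ ϱ i → E i j l = 0 := by
    intro i j l hne
    have := congrFun (congrFun (hEd i) j) l
    rw [Matrix.diagonal_mul, Matrix.smul_apply, smul_eq_mul, ← sub_eq_zero, ← sub_mul,
      mul_eq_zero] at this
    exact this.resolve_left (sub_ne_zero.2 hne)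
  -- Otherwise row `j` would vanish in every `E i`, hence in their sum, the identity.
  have hex : ∀ j, ∃ i, d j = ϱ i := by
    intro j
    by_contra! hj
    have := congrFun (congrFun hEsum j) j
    rw [Matrix.sum_apply, Finset.sum_eq_zero fun i _ => hent i j j (hj i), Matrix.one_apply_eq]
      at this
    exact zero_ne_one this
  choose f hf using hex
  -- Row `j` is nonzero in `E (f j)` only, so there it must equal row `j` of the identity.
  have hEdiag : ∀ i, E i = Matrix.diagonal (fun j => if f j = i then 1 else 0) := by
    intro i
    ext j l
    by_cases hji : f j = i
    · have := congrFun (congrFun hEsum j) l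
      rw [Matrix.sum_apply, Finset.sum_eq_single i] at this
      · rw [this, Matrix.diagonal_apply, Matrix.one_apply]
        simp [hji]
      · intro k _ hk
        refine hent k j l fun e => hk ?_
        rw [hf j] at e
        rw [← hji, h.strictAnti.injective e]
      · simp
    · rw [hent i j l fun e => hji (h.strictAnti.injective (by rw [← hf j, e])),
        Matrix.diagonal_apply]
      simp [hji]
  refine ⟨O, f, h1, fun i => by rw [← hEdiag, ← hDE], fun i => ?_⟩
  have := h.trace_eq i
  rw [hDE, Matrix.mul_assoc, Matrix.trace_mul_comm, Matrix.mul_assoc, h1, Matrix.mul_one, hEdiag,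
    Matrix.trace_diagonal, Finset.sum_boole] at this
  exact_mod_cast this

theorem sum_smul_mul_sum_inv_smul (h : IsSpectralDecomposition W ϱ ν D) {t : Fin r → ℝ}
    (ht : ∀ i, t i ≠ 0) : (∑ i, t i • D i) * ∑ i, (t i)⁻¹ • D i = 1 := by
  rw [Finset.sum_mul, ← h.sum_one]
  refine Finset.sum_congr rfl fun i _ => ?_
  rw [Finset.mul_sum, Finset.sum_eq_single i]
  · rw [Matrix.smul_mul, Matrix.mul_smul, h.idem, smul_smul, mul_inv_cancel₀ (ht i), one_smul]
  · intro k _ hk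
    rw [Matrix.smul_mul, Matrix.mul_smul, h.orth i k hk.symm, smul_zero, smul_zero]
  · simp

theorem det_sum_smul (h : IsSpectralDecomposition W ϱ ν D) (t : Fin r → ℝ) :
    (∑ i, t i • D i).det = ∏ i, t i ^ ν i := by
  obtain ⟨O, f, h1, hDO, hν⟩ := h.exists_diagonalization
  have e : ∑ i, t i • D i = O * Matrix.diagonal (fun j => t (f j)) * O.transpose := by
    have : Matrix.diagonal (fun j => t (f j))
        = ∑ i, t i • Matrix.diagonal (fun j => if f j = i then (1 : ℝ) else 0) := by
      ext j l
      rw [Matrix.sum_apply, Matrix.diagonal_apply]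
      by_cases hjl : j = l <;> simp [hjl]
    rw [this, Finset.mul_sum, Finset.sum_mul]
    exact Finset.sum_congr rfl fun i _ => by rw [hDO, Matrix.mul_smul, Matrix.smul_mul]
  rw [e, Matrix.det_mul_comm, ← Matrix.mul_assoc, h1, Matrix.one_mul, Matrix.det_diagonal,
    ← Finset.prod_fiberwise (s := Finset.univ) (g := f)]
  refine Finset.prod_congr rfl fun i _ => ?_
  rw [← hν i]
  exact Finset.prod_eq_pow_card fun j hj => by rw [(Finset.mem_filter.1 hj).2]

theorem loglik_eq (h : IsSpectralDecomposition W ϱ ν D) {t : Fin r → ℝ} (ht : ∀ i, 0 < t i)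
    (y : Fin m → ℝ) : loglik D t y = -((m : ℝ) / 2) * Real.log (2 * Real.pi)
      - 1 / 2 * ∑ i, ν i * Real.log (t i) - 1 / 2 * ∑ i, (y ⬝ᵥ (D i).mulVec y) / t i := by
  have hinv : (∑ i, t i • D i)⁻¹ = ∑ i, (t i)⁻¹ • D i :=
    Matrix.inv_eq_right_inv (h.sum_smul_mul_sum_inv_smul fun i => (ht i).ne')
  have hdet : 0 < ∏ i, t i ^ ν i := Finset.prod_pos fun i _ => pow_pos (ht i) _
  have hpi : 0 < (2 * Real.pi) ^ m := by positivity
  rw [loglik, normalDensity, hinv, h.det_sum_smul,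
    Real.log_mul (by positivity) (Real.exp_pos _).ne', Real.log_exp, Real.log_inv,
    Real.log_sqrt (by positivity), Real.log_mul hpi.ne' hdet.ne', Real.log_pow,
    Real.log_prod fun i _ => (pow_pos (ht i) _).ne', Matrix.sum_mulVec, dotProduct_sum]
  simp only [Real.log_pow, Matrix.smul_mulVec, dotProduct_smul, smul_eq_mul, div_eq_inv_mul]
  ring

end IsSpectralDecomposition

-- Whitening the projected Gaussian vector; joint law of the quadratic forms.

theorem IsPenroseInverse.pinv {n k : ℕ} (X : Matrix (Fin n) (Fin k) ℝ) :
    IsPenroseInverse X (pinv X) :=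
  (exists_isPenroseInverse X).choose_spec

/-- An isometric basis matrix of the complement of the column space annihilates the columns. -/
theorem transpose_mul_eq_zero {n k m : ℕ} {X : Matrix (Fin n) (Fin k) ℝ}
    {B : Matrix (Fin n) (Fin m) ℝ} (hBBt : B * B.transpose = 1 - X * LambertLRT.pinv X)
    (hBtB : B.transpose * B = 1) : B.transpose * X = 0 := by
  calc B.transpose * X = B.transpose * (B * B.transpose) * X := by
        rw [← Matrix.mul_assoc B.transpose, hBtB, Matrix.one_mul]
    _ = 0 := by
        rw [hBBt, Matrix.mul_assoc, Matrix.sub_mul, Matrix.one_mul,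
          (IsPenroseInverse.pinv X).mul_mul_self, sub_self, Matrix.mul_zero]

/-- A linear map that diagonalizes the covariance and annihilates the mean turns a Gaussian
vector into a vector of independent standard normal variables. -/
theorem map_mulVec_multivariateGaussian {n m : ℕ} {μ : EuclideanSpace ℝ (Fin n)}
    {S : Matrix (Fin n) (Fin n) ℝ} (hS : S.PosSemidef) {A : Matrix (Fin m) (Fin n) ℝ}
    (hμ : A.mulVec μ.ofLp = 0) (hA : A * S * A.transpose = 1) :
    (multivariateGaussian μ S).map (fun x => A.mulVec x.ofLp)
      = Measure.pi fun _ => gaussianReal 0 1 := by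
  have hm : Measurable fun x : EuclideanSpace ℝ (Fin n) => A.mulVec x.ofLp := by
    refine Continuous.measurable ?_
    fun_prop
  have : IsProbabilityMeasure ((multivariateGaussian μ S).map (fun x => A.mulVec x.ofLp)) :=
    Measure.isProbabilityMeasure_map hm.aemeasurable
  refine charFun_eq_pi_iff.1 fun t => ?_
  have e : ∀ x : EuclideanSpace ℝ (Fin n), inner ℝ (WithLp.toLp 2 (A.mulVec x.ofLp)) t
      = inner ℝ x (WithLp.toLp 2 (A.transpose.mulVec t.ofLp)) := by
    intro x
    simp only [EuclideanSpace.inner_eq_star_dotProduct, star_trivial]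
    rw [Matrix.dotProduct_mulVec, Matrix.mulVec_transpose]
  rw [charFun_apply, integral_map (by fun_prop) (by fun_prop),
    integral_map hm.aemeasurable (by fun_prop)]
  simp_rw [e]
  -- The adjoint identity `e` is used twice: to read the characteristic function at `Aᵀ t`, and to
  -- turn its mean term into the inner product of `A μ = 0` with `t`.
  rw [← charFun_apply, charFun_multivariateGaussian hS, real_inner_comm, ← e, hμ]
  simp only [charFun_gaussianReal, ← Complex.exp_sum]
  congr 1
  have : (A.transpose.mulVec t.ofLp) ⬝ᵥ S.mulVec (A.transpose.mulVec t.ofLp)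
      = ∑ j, t j ^ 2 := by
    rw [Matrix.mulVec_transpose, ← Matrix.dotProduct_mulVec, Matrix.mulVec_mulVec,
      ← Matrix.mulVec_transpose, Matrix.mulVec_mulVec, hA, Matrix.one_mulVec]
    simp [dotProduct, sq]
  rw [this]
  simp [Finset.sum_div]

theorem dotProduct_mul_diagonal_mulVec {m : ℕ} (O : Matrix (Fin m) (Fin m) ℝ)
    (p : Fin m → Prop) [DecidablePred p] (y : Fin m → ℝ) :
    y ⬝ᵥ (O * Matrix.diagonal (fun j => if p j then 1 else 0) * O.transpose).mulVec y
      = ∑ j with p j, (O.transpose.mulVec y) j ^ 2 := by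
  rw [Matrix.mul_assoc, ← Matrix.mulVec_mulVec, Matrix.dotProduct_mulVec,
    ← Matrix.mulVec_transpose, ← Matrix.mulVec_mulVec, dotProduct, Finset.sum_filter]
  refine Finset.sum_congr rfl fun j _ => ?_
  rw [Matrix.mulVec_diagonal]
  split_ifs <;> ring

/-- The quadratic form at an eigenvector is `ϱ i` times its squared length. This is what makes the
canonical variance components positive. -/
theorem IsSpectralDecomposition.eigenvalue_nonneg {m r : ℕ} {W : Matrix (Fin m) (Fin m) ℝ}
    {ϱ : Fin r → ℝ} {ν : Fin r → ℕ} {D : Fin r → Matrix (Fin m) (Fin m) ℝ}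
    (h : IsSpectralDecomposition W ϱ ν D) (hW : W.PosSemidef) (i : Fin r) : 0 ≤ ϱ i := by
  obtain ⟨x, hx⟩ := (h.hasEigenvalue i).exists_hasEigenvector
  have hxW : W.mulVec x = ϱ i • x := by
    have := hx.apply_eq_smul
    rwa [Matrix.toLin'_apply] at this
  have h1 : 0 ≤ ϱ i * (x ⬝ᵥ x) := by
    have := hW.dotProduct_mulVec_nonneg x
    rwa [hxW, star_trivial, dotProduct_smul, smul_eq_mul] at this
  have h2 : 0 < x ⬝ᵥ x := by
    have := (Matrix.dotProduct_star_self_pos_iff (v := x)).2 hx.2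
    rwa [star_trivial] at this
  exact nonneg_of_mul_nonneg_left h1 h2

/-- The quadratic forms in the spectral projections, standardized by the canonical variance
components, are jointly distributed as independent chi-squared variables. -/
theorem hasLaw_quadraticForms {Ω : Type*} [MeasurableSpace Ω] {P : Measure Ω} {n m r : ℕ}
    {μ : EuclideanSpace ℝ (Fin n)} {V : Matrix (Fin n) (Fin n) ℝ} (hV : V.PosSemidef)
    {a b : ℝ} (ha : 0 ≤ a) (hb : 0 < b) {Y : Ω → EuclideanSpace ℝ (Fin n)}
    (hY : HasLaw Y (multivariateGaussian μ (a • V + b • (1 : Matrix (Fin n) (Fin n) ℝ))) P)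
    {B : Matrix (Fin n) (Fin m) ℝ} (hBtB : B.transpose * B = 1)
    (hBμ : B.transpose.mulVec μ.ofLp = 0) {ϱ : Fin r → ℝ} {ν : Fin r → ℕ}
    {D : Fin r → Matrix (Fin m) (Fin m) ℝ}
    (hD : IsSpectralDecomposition (B.transpose * V * B) ϱ ν D) (hpos : ∀ i, 0 < a * ϱ i + b) :
    HasLaw (fun ω i => (B.transpose.mulVec (Y ω).ofLp ⬝ᵥ
      (D i).mulVec (B.transpose.mulVec (Y ω).ofLp)) / (a * ϱ i + b))
      (Measure.pi fun i => chiSq (ν i)) P := by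
  obtain ⟨O, f, h1, hDO, hν⟩ := hD.exists_diagonalization
  set ϑ : Fin r → ℝ := fun i => a * ϱ i + b with hϑ
  set T : Matrix (Fin m) (Fin m) ℝ := Matrix.diagonal (fun j => (√(ϑ (f j)))⁻¹) with hT
  -- Whitening map: project by `Bᵀ`, rotate to the eigenbasis, where coordinate `j` has variance `ϑ
  -- (f j)`, and rescale by `T`.
  set A : Matrix (Fin m) (Fin n) ℝ := T * O.transpose * B.transpose with hA
  have hS : (a • V + b • (1 : Matrix (Fin n) (Fin n) ℝ)).PosSemidef :=
    (hV.smul ha).add (Matrix.PosSemidef.one.smul hb.le)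
  have hW : O.transpose * (B.transpose * V * B) * O = Matrix.diagonal (fun j => ϱ (f j)) := by
    have hWO : B.transpose * V * B = O * Matrix.diagonal (fun j => ϱ (f j)) * O.transpose := by
      have : Matrix.diagonal (fun j => ϱ (f j))
          = ∑ i, ϱ i • Matrix.diagonal (fun j => if f j = i then (1 : ℝ) else 0) := by
        ext j l
        rw [Matrix.sum_apply, Matrix.diagonal_apply]
        by_cases hjl : j = l <;> simp [hjl]
      rw [this, Finset.mul_sum, Finset.sum_mul, hD.sum_smul]
      exact Finset.sum_congr rfl fun i _ => by rw [hDO, Matrix.mul_smul, Matrix.smul_mul]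
    rw [hWO]
    calc O.transpose * (O * Matrix.diagonal (fun j => ϱ (f j)) * O.transpose) * O
        = (O.transpose * O) * Matrix.diagonal (fun j => ϱ (f j)) * (O.transpose * O) := by
          simp only [Matrix.mul_assoc]
      _ = _ := by rw [h1, Matrix.one_mul, Matrix.mul_one]
  have hAμ : A.mulVec μ.ofLp = 0 := by
    rw [hA, ← Matrix.mulVec_mulVec, hBμ, Matrix.mulVec_zero]
  have hASA : A * (a • V + b • (1 : Matrix (Fin n) (Fin n) ℝ)) * A.transpose = 1 := by
    have hAT : A.transpose = B * O * T := by
      rw [hA, Matrix.transpose_mul, Matrix.transpose_mul, Matrix.transpose_transpose,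
        Matrix.transpose_transpose, hT, Matrix.diagonal_transpose, Matrix.mul_assoc]
    calc A * (a • V + b • (1 : Matrix (Fin n) (Fin n) ℝ)) * A.transpose
        = T * (a • (O.transpose * (B.transpose * V * B) * O)
          + b • (O.transpose * (B.transpose * B) * O)) * T := by
          rw [hAT, hA]
          simp only [Matrix.mul_add, Matrix.add_mul, Matrix.mul_smul, Matrix.smul_mul,
            Matrix.mul_one, Matrix.mul_assoc]
      _ = 1 := by
          rw [hW, hBtB, Matrix.mul_one, h1, hT]
          ext j l
          rw [Matrix.mul_diagonal, Matrix.diagonal_mul, Matrix.add_apply, Matrix.smul_apply,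
            Matrix.smul_apply]
          by_cases hjl : j = l
          · subst hjl
            simp only [Matrix.diagonal_apply_eq, Matrix.one_apply_eq, smul_eq_mul, mul_one]
            have h2 := Real.mul_self_sqrt (hpos (f j)).le
            have h3 := (Real.sqrt_pos.2 (hpos (f j))).ne'
            change (√(a * ϱ (f j) + b))⁻¹ * (a * ϱ (f j) + b) * (√(a * ϱ (f j) + b))⁻¹ = 1
            nth_rewrite 2 [← h2]
            field_simp
          · simp [hjl]
  have hAmeas : Measurable fun x : EuclideanSpace ℝ (Fin n) => A.mulVec x.ofLp := by
    refine Continuous.measurable ?_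
    fun_prop
  have hlaw1 : HasLaw (fun x : EuclideanSpace ℝ (Fin n) => A.mulVec x.ofLp)
      (Measure.pi fun _ => gaussianReal 0 1)
      (multivariateGaussian μ (a • V + b • (1 : Matrix (Fin n) (Fin n) ℝ))) :=
    ⟨hAmeas.aemeasurable, map_mulVec_multivariateGaussian hS hAμ hASA⟩
  have hlaw2 : HasLaw (fun (x : Fin m → ℝ) (i : Fin r) => ∑ j with f j = i, x j ^ 2)
      (Measure.pi fun i => chiSq (ν i)) (Measure.pi fun _ => gaussianReal 0 1) :=
    ⟨Measurable.aemeasurable (by fun_prop),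
      map_block_sum_sq_pi_gaussianReal f ν hD.multiplicity_pos hν⟩
  have := hlaw2.comp (hlaw1.comp hY)
  convert this using 1
  funext ω i
  simp only [Function.comp]
  rw [hDO, dotProduct_mul_diagonal_mulVec, Finset.sum_div]
  refine Finset.sum_congr rfl fun j hj => ?_
  rw [hA, Matrix.mul_assoc, ← Matrix.mulVec_mulVec, ← Matrix.mulVec_mulVec, hT,
    Matrix.mulVec_diagonal, (Finset.mem_filter.1 hj).2, mul_pow, inv_pow, hϑ,
    Real.sq_sqrt (hpos i).le, div_eq_inv_mul]

-- Maximizing the likelihood.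

/-- The function `t ↦ log t + s / t` has its unique minimum at `s`. -/
theorem log_add_one_lt {s t : ℝ} (hs : 0 < s) (ht : 0 < t) (hst : t ≠ s) :
    Real.log s + 1 < Real.log t + s / t := by
  have h := Real.log_lt_sub_one_of_pos (div_pos hs ht)
    fun e => hst ((div_eq_one_iff_eq ht.ne').1 e).symm
  rw [Real.log_div hs.ne' ht.ne'] at h
  linarith

section Likelihood

variable {m r : ℕ} {W : Matrix (Fin m) (Fin m) ℝ} {ϱ : Fin r → ℝ} {ν : Fin r → ℕ}
  {D : Fin r → Matrix (Fin m) (Fin m) ℝ}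

theorem loglik_lt_of_ne (h : IsSpectralDecomposition W ϱ ν D) {y : Fin m → ℝ} {s t : Fin r → ℝ}
    (hs : ∀ i, 0 < s i) (hy : ∀ i, y ⬝ᵥ (D i).mulVec y = ν i * s i) (ht : ∀ i, 0 < t i)
    (hts : t ≠ s) : loglik D t y < loglik D s y := by
  have hν : ∀ i, (0 : ℝ) < ν i := fun i => by exact_mod_cast h.multiplicity_pos i
  obtain ⟨k, hk⟩ := Function.ne_iff.1 hts
  have hlt : ∑ i, ν i * (Real.log (s i) + s i / s i)
      < ∑ i, ν i * (Real.log (t i) + s i / t i) := by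
    refine Finset.sum_lt_sum (fun i _ => ?_) ⟨k, Finset.mem_univ k, ?_⟩
    · rw [div_self (hs i).ne']
      refine mul_le_mul_of_nonneg_left ?_ (hν i).le
      by_cases hi : t i = s i
      · rw [hi, div_self (hs i).ne']
      · exact (log_add_one_lt (hs i) (ht i) hi).le
    · rw [div_self (hs k).ne']
      exact mul_lt_mul_of_pos_left (log_add_one_lt (hs k) (ht k) hk) (hν k)
  simp only [mul_add, Finset.sum_add_distrib, ← mul_div_assoc] at hlt
  rw [h.loglik_eq hs, h.loglik_eq ht]
  simp only [hy]
  linarith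

/-- The supremum is attained at `s`; the bound by the value there also keeps the real `⨆` from
taking its default value. -/
theorem lrt_eq (h : IsSpectralDecomposition W ϱ ν D) {y : Fin m → ℝ} {s : Fin r → ℝ}
    (hs : ∀ i, 0 < s i) (hy : ∀ i, y ⬝ᵥ (D i).mulVec y = ν i * s i) (ϑ₀ : Fin r → ℝ) :
    lrt D ϑ₀ y = -2 * (loglik D ϑ₀ y - loglik D s y) := by
  have hle : ∀ t : {t : Fin r → ℝ // ∀ i, 0 < t i}, loglik D t.1 y ≤ loglik D s y := by
    intro t
    by_cases hts : t.1 = s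
    · rw [hts]
    · exact (loglik_lt_of_ne h hs hy t.2 hts).le
  have : Nonempty {t : Fin r → ℝ // ∀ i, 0 < t i} := ⟨⟨s, hs⟩⟩
  rw [lrt, le_antisymm (ciSup_le hle)
    (le_ciSup (f := fun t : {t : Fin r → ℝ // ∀ i, 0 < t i} => loglik D t.1 y)
      ⟨loglik D s y, Set.forall_mem_range.2 hle⟩ ⟨s, hs⟩)]

theorem neg_two_mul_loglik_sub (h : IsSpectralDecomposition W ϱ ν D) {y : Fin m → ℝ}
    {u ϑ₀ : Fin r → ℝ} (hu : ∀ i, 0 < u i / ν i) (hy : ∀ i, y ⬝ᵥ (D i).mulVec y = u i)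
    (hϑ₀ : ∀ i, 0 < ϑ₀ i) :
    -2 * (loglik D ϑ₀ y - loglik D (fun i => u i / ν i) y)
      = ∑ i, ((u i / ϑ₀ i - ν i) - ν i * Real.log (u i / (ν i * ϑ₀ i))) := by
  have hν : ∀ i, (0 : ℝ) < ν i := fun i => by exact_mod_cast h.multiplicity_pos i
  have e : ∀ i, (u i / ϑ₀ i - ν i) - ν i * Real.log (u i / (ν i * ϑ₀ i))
      = u i / ϑ₀ i - u i / (u i / ν i)
        - (ν i * Real.log (u i / ν i) - ν i * Real.log (ϑ₀ i)) := by
    intro i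
    have hui : u i ≠ 0 := fun e => by simpa [e] using hu i
    -- At the maximizer each quadratic term `u i / (u i / ν i)` equals `ν i`, which is the centring
    -- constant of the summand.
    rw [← div_div, Real.log_div (hu i).ne' (hϑ₀ i).ne', div_div_cancel₀ hui]
    ring
  rw [h.loglik_eq hϑ₀, h.loglik_eq hu]
  simp only [e, hy, Finset.sum_sub_distrib]
  ring

end Likelihood

/-- Expanding the logarithm matches the two expressions for `q > 0`. At `q = 0` they may differ,
since `Real.log 0 = 0`, hence the almost sure comparison. -/
theorem hasLaw_LW_chiSq {ν : ℕ} (hν : 0 < ν) {c : ℝ} (hc : 0 < c) :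
    HasLaw (fun q => (c * q - ν) - ν * Real.log (c * q / ν))
      (LW (chiSq ν) (ν * (Real.log (ν / c) - 1), (ν : ℝ), c)) (chiSq ν) := by
  have hν' : (0 : ℝ) < ν := by exact_mod_cast hν
  refine HasLaw.congr (X := fun q => ν * (Real.log (ν / c) - 1) - ν * Real.log q + c * q)
    ⟨Measurable.aemeasurable (by fun_prop), rfl⟩ ?_
  filter_upwards [ae_chiSq_pos ν] with q hq
  rw [mul_comm c q, mul_div_assoc, Real.log_mul hq.ne' (div_pos hc hν').ne',
    Real.log_div hc.ne' hν'.ne', Real.log_div hν'.ne' hc.ne']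
  ring

theorem standardLW_eq_LW {ν : ℕ} (hν : 0 < ν) :
    standardLW ν = LW (chiSq ν) (ν * (Real.log ν - 1), (ν : ℝ), 1) := by
  have := (hasLaw_LW_chiSq hν one_pos).map_eq
  simpa [standardLW] using this

end LambertLRT

-- Laws of the summands and of the likelihood ratio statistic.

theorem mainTheorem8 {Ω : Type*} [MeasurableSpace Ω] (P : Measure Ω) [IsProbabilityMeasure P]
    {n k m r : ℕ}
    -- the two-variance-component model
    (X : Matrix (Fin n) (Fin k) ℝ) (β : Fin k → ℝ)
    (V : Matrix (Fin n) (Fin n) ℝ) (hV : V.PosSemidef)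
    (σ₁sq σ₂sq : ℝ) (hσ₁ : 0 ≤ σ₁sq) (hσ₂ : 0 < σ₂sq)
    (Y : Ω → EuclideanSpace ℝ (Fin n))
    (hY : HasLaw Y (multivariateGaussian (WithLp.toLp 2 (X.mulVec β))
      (σ₁sq • V + σ₂sq • (1 : Matrix (Fin n) (Fin n) ℝ))) P)
    -- the maximal invariant
    (hm : m + X.rank = n)
    (B : Matrix (Fin n) (Fin m) ℝ)
    (hBBt : B * B.transpose = 1 - X * LambertLRT.pinv X) (hBtB : B.transpose * B = 1)
    (Yt : Ω → Fin m → ℝ) (hYt : ∀ ω, Yt ω = B.transpose.mulVec (Y ω).ofLp)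
    -- the spectral decomposition, the canonical variance components and the statistics `U i`
    (ϱ : Fin r → ℝ) (ν : Fin r → ℕ) (D : Fin r → Matrix (Fin m) (Fin m) ℝ)
    (hD : LambertLRT.IsSpectralDecomposition (B.transpose * V * B) ϱ ν D)
    (ϑ : Fin r → ℝ) (hϑ : ∀ i, ϑ i = σ₁sq * ϱ i + σ₂sq)
    (U : Fin r → Ω → ℝ) (hU : ∀ i ω, U i ω = Yt ω ⬝ᵥ (D i).mulVec (Yt ω))
    -- the hypothetical value
    (ϑ₀ : Fin r → ℝ) (hϑ₀ : ∀ i, 0 < ϑ₀ i)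
    -- the summands of the statistic
    (Z : Fin r → Ω → ℝ)
    (hZ : ∀ i ω, Z i ω = (U i ω / ϑ₀ i - ν i) - ν i * Real.log (U i ω / (ν i * ϑ₀ i))) :
    -- the restricted log-likelihood
    (∀ t : Fin r → ℝ, (∀ i, 0 < t i) → ∀ ω, LambertLRT.loglik D t (Yt ω) =
      -((m : ℝ) / 2) * Real.log (2 * Real.pi) - 1 / 2 * ∑ i, ν i * Real.log (t i)
        - 1 / 2 * ∑ i, U i ω / t i) ∧
    -- almost surely `U i / ν i` is the unique restricted maximum likelihood estimate, and the
    -- likelihood ratio statistic is the stated sum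
    (∀ᵐ ω ∂P,
      (∀ i, 0 < U i ω / ν i) ∧
      (∀ t : Fin r → ℝ, (∀ i, 0 < t i) → t ≠ (fun i => U i ω / ν i) →
        LambertLRT.loglik D t (Yt ω) < LambertLRT.loglik D (fun i => U i ω / ν i) (Yt ω)) ∧
      LambertLRT.lrt D ϑ₀ (Yt ω) = -2 * (LambertLRT.loglik D ϑ₀ (Yt ω)
        - LambertLRT.loglik D (fun i => U i ω / ν i) (Yt ω)) ∧
      LambertLRT.lrt D ϑ₀ (Yt ω) = ∑ i, Z i ω) ∧
    -- the `U i / ϑ i` are independent chi-squared variables, and the statistic in terms of them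
    iIndepFun (fun i ω => U i ω / ϑ i) P ∧
    (∀ i, HasLaw (fun ω => U i ω / ϑ i) (LambertLRT.chiSq (ν i)) P) ∧
    (∀ i ω, Z i ω = (ϑ i / ϑ₀ i * (U i ω / ϑ i) - ν i)
      - ν i * Real.log (ϑ i / ϑ₀ i * (U i ω / ϑ i) / ν i)) ∧
    -- the summands are independent, with the stated laws in general
    iIndepFun Z P ∧
    (∀ i, HasLaw (Z i) (LambertLRT.LW (LambertLRT.chiSq (ν i))
      (ν i * (Real.log (ν i / (ϑ i / ϑ₀ i)) - 1), (ν i : ℝ), ϑ i / ϑ₀ i)) P) ∧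
    HasLaw (fun ω => LambertLRT.lrt D ϑ₀ (Yt ω))
      ((Measure.pi fun i => LambertLRT.LW (LambertLRT.chiSq (ν i))
        (ν i * (Real.log (ν i / (ϑ i / ϑ₀ i)) - 1), (ν i : ℝ), ϑ i / ϑ₀ i)).map
          (fun z => ∑ i, z i)) P ∧
    -- and under the null hypothesis
    (ϑ = ϑ₀ →
      (∀ i, HasLaw (Z i) (LambertLRT.standardLW (ν i)) P) ∧
      (∀ i, HasLaw (Z i) (LambertLRT.LW (LambertLRT.chiSq (ν i))
        (ν i * (Real.log (ν i) - 1), (ν i : ℝ), 1)) P) ∧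
      HasLaw (fun ω => LambertLRT.lrt D ϑ₀ (Yt ω))
        ((Measure.pi fun i => LambertLRT.standardLW (ν i)).map (fun z => ∑ i, z i)) P) := by

  have hBX : B.transpose * X = 0 := LambertLRT.transpose_mul_eq_zero hBBt hBtB
  have hW : (B.transpose * V * B).PosSemidef := by
    have := hV.conjTranspose_mul_mul_same B
    rwa [Matrix.conjTranspose_eq_transpose_of_trivial] at this
  have hϑpos : ∀ i, 0 < ϑ i := fun i => by
    rw [hϑ]
    exact add_pos_of_nonneg_of_pos (mul_nonneg hσ₁ (hD.eigenvalue_nonneg hW i)) hσ₂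
  have hνpos : ∀ i, 0 < ν i := hD.multiplicity_pos
  have hνpos' : ∀ i, (0 : ℝ) < ν i := fun i => by exact_mod_cast hνpos i
  have (i : Fin r) : IsProbabilityMeasure (LambertLRT.chiSq (ν i)) :=
    LambertLRT.isProbabilityMeasure_chiSq (hνpos i)
  have hQ : HasLaw (fun ω i => U i ω / ϑ i)
      (Measure.pi fun i => LambertLRT.chiSq (ν i)) P := by
    have := LambertLRT.hasLaw_quadraticForms hV hσ₁ hσ₂ hY hBtB
      (by rw [Matrix.mulVec_mulVec, hBX, Matrix.zero_mulVec]) hD fun i => hϑ i ▸ hϑpos i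
    simpa only [hU, hYt, hϑ] using this
  have hQi : ∀ i, HasLaw (fun ω => U i ω / ϑ i) (LambertLRT.chiSq (ν i)) P := fun i =>
    (measurePreserving_eval (fun i => LambertLRT.chiSq (ν i)) i).hasLaw.comp hQ
  have hQind : iIndepFun (fun i ω => U i ω / ϑ i) P := (iIndepFun_iff_hasLaw_pi_pi hQi).2 hQ
  have hZQ : ∀ i ω, Z i ω = (ϑ i / ϑ₀ i * (U i ω / ϑ i) - ν i)
      - ν i * Real.log (ϑ i / ϑ₀ i * (U i ω / ϑ i) / ν i) := fun i ω => by
    have e : ϑ i / ϑ₀ i * (U i ω / ϑ i) = U i ω / ϑ₀ i := by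
      have := (hϑpos i).ne'
      field_simp
    rw [hZ, e, div_div, mul_comm (ϑ₀ i)]
  have hZcomp : ∀ i, Z i = (fun q => (ϑ i / ϑ₀ i * q - ν i)
      - ν i * Real.log (ϑ i / ϑ₀ i * q / ν i)) ∘ fun ω => U i ω / ϑ i :=
    fun i => funext (hZQ i)
  have hZind : iIndepFun Z P := by
    have := hQind.comp (fun i q => (ϑ i / ϑ₀ i * q - ν i)
      - ν i * Real.log (ϑ i / ϑ₀ i * q / ν i)) fun i => by fun_prop
    rwa [← funext hZcomp] at this
  have hZlaw : ∀ i, HasLaw (Z i) (LambertLRT.LW (LambertLRT.chiSq (ν i))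
      (ν i * (Real.log (ν i / (ϑ i / ϑ₀ i)) - 1), (ν i : ℝ), ϑ i / ϑ₀ i)) P := fun i => by
    rw [hZcomp i]
    exact (LambertLRT.hasLaw_LW_chiSq (hνpos i) (div_pos (hϑpos i) (hϑ₀ i))).comp (hQi i)
  have hUpos : ∀ᵐ ω ∂P, ∀ i, 0 < U i ω / ν i := by
    refine ae_all_iff.2 fun i => ?_
    have := (hQi i).ae_iff (p := fun q => 0 < q) (measurableSet_lt measurable_const measurable_id).mem
    filter_upwards [this.2 (LambertLRT.ae_chiSq_pos (ν i))] with ω hω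
    exact div_pos ((div_pos_iff_of_pos_right (hϑpos i)).1 hω) (hνpos' i)
  have hy : ∀ ω i, Yt ω ⬝ᵥ (D i).mulVec (Yt ω) = ν i * (U i ω / ν i) := fun ω i => by
    rw [← hU, mul_div_cancel₀ _ (hνpos' i).ne']
  have hML : ∀ᵐ ω ∂P, (∀ i, 0 < U i ω / ν i) ∧
      (∀ t : Fin r → ℝ, (∀ i, 0 < t i) → t ≠ (fun i => U i ω / ν i) →
        LambertLRT.loglik D t (Yt ω) < LambertLRT.loglik D (fun i => U i ω / ν i) (Yt ω)) ∧
      LambertLRT.lrt D ϑ₀ (Yt ω) = -2 * (LambertLRT.loglik D ϑ₀ (Yt ω)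
        - LambertLRT.loglik D (fun i => U i ω / ν i) (Yt ω)) ∧
      LambertLRT.lrt D ϑ₀ (Yt ω) = ∑ i, Z i ω := by
    filter_upwards [hUpos] with ω hω
    have hl := LambertLRT.lrt_eq hD hω (hy ω) ϑ₀
    refine ⟨hω, fun t ht hne => LambertLRT.loglik_lt_of_ne hD hω (hy ω) ht hne, hl, ?_⟩
    rw [hl, LambertLRT.neg_two_mul_loglik_sub hD hω (fun i => (hU i ω).symm) hϑ₀]
    exact Finset.sum_congr rfl fun i _ => (hZ i ω).symm
  -- Kept generic in the marginals `κ` so that it serves both the general laws and the standard ones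
  -- under the null hypothesis.
  have hlrt : ∀ κ : Fin r → Measure ℝ, (∀ i, HasLaw (Z i) (κ i) P) →
      HasLaw (fun ω => LambertLRT.lrt D ϑ₀ (Yt ω))
        ((Measure.pi κ).map (fun z => ∑ i, z i)) P := fun κ hκ => by
    have hsum : HasLaw (fun z : Fin r → ℝ => ∑ i, z i)
        ((Measure.pi κ).map (fun z => ∑ i, z i)) (Measure.pi κ) :=
      ⟨Measurable.aemeasurable (by fun_prop), rfl⟩
    refine (hsum.comp (hZind.hasLaw_pi hκ)).congr ?_
    filter_upwards [hML] with ω hω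
    exact hω.2.2.2
  refine ⟨fun t ht ω => ?_, hML, hQind, hQi, hZQ, hZind, hZlaw, hlrt _ hZlaw, fun hnull => ?_⟩
  · rw [hD.loglik_eq ht]
    simp only [hU]
  · have hZlaw' : ∀ i, HasLaw (Z i) (LambertLRT.LW (LambertLRT.chiSq (ν i))
        (ν i * (Real.log (ν i) - 1), (ν i : ℝ), 1)) P := fun i => by
      have := hZlaw i
      rwa [hnull, div_self (hϑ₀ i).ne', div_one] at this
    have hZstd : ∀ i, HasLaw (Z i) (LambertLRT.standardLW (ν i)) P := fun i => by
      rw [LambertLRT.standardLW_eq_LW (hνpos i)]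
      exact hZlaw' i
    exact ⟨hZstd, hZlaw', hlrt _ hZstd⟩
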